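/- Let $K$ be a number field, let $B$ be its ring of integers, and let $(e_i)_{1\le i\le n}$ be a $\mathbb{Z}$-basis of $B$. Put $S=\mathbb{Z}[T_1,\dots,T_n]$, let $\xi=\sum_i T_i\otimes e_i\in S\otimes_{\mathbb{Z}}B$ be the generic element of $B$, and let $F(X)\in S[X]$ be the generic characteristic polynomial of $B$, that is, the characteristic polynomial of multiplication by $\xi$ on the free $S$-module $S\otimes_{\mathbb{Z}}B$. Let $\operatorname{disc}(F)\in S$ be the discriminant of the monic polynomial $F$, and let its content $c\ge 0$ be the gcd of its coefficients in $\mathbb{Z}$. Then the content of $\operatorname{disc}(F)$ is the discriminant of $B$ (or of $K$), in the following sense: (1) the ideal $c\,\mathbb{Z}$ is the discriminant ideal of $B$ over $\mathbb{Z}$, i.e. the image of the linear map $(\wedge^n B)\otimes_{\mathbb{Z}}(\wedge^n B)\to\mathbb{Z}$, $(x_1\wedge\dots\wedge x_n)\otimes(y_1\wedge\dots\wedge y_n)\mapsto\det\big(\operatorname{Tr}_{B/\mathbb{Z}}(x_iy_j)\big)_{i,j}$; (2) $c=|d_K|$, where $d_K$ is the discriminant of the number field $K$. -/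

import Mathlib

open scoped TensorProduct

noncomputable section

/-- The generic element `ξ = ∑ i, T i ⊗ e i` of the `A`-algebra `B` with respect to the
`A`-basis `e`. It is an element of `A[T] ⊗[A] B = B[T]`, the variables `T i` being indexed by
the index type of the basis. -/
def genericElement {A B ι : Type*} [CommRing A] [CommRing B] [Algebra A B] [Fintype ι]
    (e : Module.Basis ι A B) : MvPolynomial ι A ⊗[A] B :=
  ∑ i, (MvPolynomial.X i : MvPolynomial ι A) ⊗ₜ[A] e i

/-- The generic characteristic polynomial `F(X)` of `B` over `A` with respect to the basis `e`:
the characteristic polynomial, over `A[T]`, of multiplication by the generic element on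
`A[T] ⊗[A] B`. -/
def genericCharpoly {A B ι : Type*} [CommRing A] [CommRing B] [Algebra A B]
    [Module.Free A B] [Module.Finite A B] [Fintype ι]
    (e : Module.Basis ι A B) : Polynomial (MvPolynomial ι A) :=
  (Algebra.lmul (MvPolynomial ι A) (MvPolynomial ι A ⊗[A] B) (genericElement e)).charpoly

/-- The content of a polynomial in several variables with integer coefficients: the
(nonnegative) gcd of its coefficients. -/
def mvContent {ι : Type*} (p : MvPolynomial ι ℤ) : ℤ :=
  p.support.gcd fun m => p.coeff m

/-- The linear map `d : (⋀ⁿ E) ⊗ (⋀ⁿ E) → S`, extension to the `n`-th exterior power of the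
bilinear trace form `(x, y) ↦ Tr (x y)` of the `S`-algebra `E`; it sends
`(x₁ ∧ ⋯ ∧ xₙ) ⊗ (y₁ ∧ ⋯ ∧ yₙ)` to `det (Tr (xᵢ yⱼ))`. -/
def discriminantMap (S E : Type*) [CommRing S] [CommRing E] [Algebra S E] (n : ℕ) :
    (⋀[S]^n E) ⊗[S] (⋀[S]^n E) →ₗ[S] S :=
  TensorProduct.lift
    (exteriorPower.pairingDual S E n ∘ₗ exteriorPower.map n (Algebra.traceForm S E))

/-- The discriminant of an `S`-algebra `E` that is finite and free of rank `n` over `S`: the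
ideal of `S` that is the image of `d : (⋀ⁿ E) ⊗ (⋀ⁿ E) → S`. -/
def discriminantIdeal (S E : Type*) [CommRing S] [CommRing E] [Algebra S E] : Ideal S :=
  LinearMap.range (discriminantMap S E (Module.finrank S E))

end

/-! The discriminant of `F` is the Hankel determinant of the traces of `ξ ^ (i + j)`, since over an
algebraically closed field both are the squared Vandermonde determinant of the eigenvalues. Changing
basis from `e` to the powers of `ξ` turns it into `genericIndex e ^ 2` times the discriminant of
`e`, which is `d_K` (`discr_genericCharpoly`).

It remains to see that no prime `p` divides `genericIndex e ^ 2`, i.e. that over an algebraic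
closure `k` of `ZMod p` the index is nonzero at some point; it suffices that some element of `k ⊗ B`
has minimal polynomial of degree `n`. Now `B / pB` is the product of the `B ⧸ Q ^ e` over the primes
`Q` above `p`, and each factor has one generator `θ`: lift a primitive element of the residue field
so that its minimal polynomial takes at `θ` a value of `Q`-order exactly 1. Over the infinite field
`k` the generators can be translated until their minimal polynomials are coprime, then glued by the
Chinese remainder theorem. Over `ZMod p` itself there may be too few translations. -/

/-! ### Discriminants of monic polynomials. -/

open Polynomial in
theorem Lagrange.natDegree_nodal_univ {K : Type*} [Field K] {n : ℕ} (v : Fin n → K) :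
    (Lagrange.nodal Finset.univ v).natDegree = n := by
  simp

open Polynomial in
theorem Lagrange.discr_nodal {K : Type*} [Field K] {n : ℕ} (v : Fin n → K) :
    (Lagrange.nodal Finset.univ v).discr = (Matrix.vandermonde v).det ^ 2 := by
  classical
  rcases Nat.eq_zero_or_pos n with rfl | hn
  · have : Lagrange.nodal Finset.univ v = C 1 := by simp [Lagrange.nodal]
    rw [this, discr_C]; simp
  set f := Lagrange.nodal Finset.univ v with hf
  have hmon : f.Monic := Lagrange.nodal_monic
  have hdeg : f.natDegree = n := Lagrange.natDegree_nodal_univ v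
  have hroots : f.roots = Finset.univ.val.map v := by
    have := roots_multiset_prod_X_sub_C (Finset.univ.val.map v)
    rwa [Multiset.map_map] at this
  have hsplit : f.Splits := by
    rw [hf, Lagrange.nodal_eq]
    exact Splits.prod fun i _ => Splits.X_sub_C _
  have hres := resultant_deriv (f := f) (natDegree_pos_iff_degree_pos.mp (hdeg ▸ hn))
  rw [resultant_eq_prod_eval f _ _ (natDegree_derivative_le f) hsplit, hmon.leadingCoeff, one_pow,
    one_mul, mul_one, hroots, Multiset.map_map] at hres
  have hprod : (Finset.univ.val.map ((fun x => eval x f.derivative) ∘ v)).prod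
      = (-1) ^ (n * (n - 1) / 2) * (Matrix.vandermonde v).det ^ 2 := by
    change ∏ i, eval (v i) f.derivative = _
    have h1 : ∀ i, eval (v i) f.derivative = ∏ j ∈ {i}ᶜ, (v i - v j) := fun i => by
      rw [hf, Lagrange.eval_nodal_derivative_eval_node_eq (Finset.mem_univ i), Lagrange.eval_nodal]
      congr 1
      ext j; simp
    simp_rw [h1]
    -- Pairing `(i, j)` with `(j, i)` gives a squared difference and one sign per pair, hence `n *
    -- (n - 1) / 2` signs.
    rw [← Finset.prod_prod_Ioi_mul_eq_prod_prod_off_diag (fun j i => v i - v j),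
      Matrix.det_vandermonde, ← Finset.prod_pow]
    simp_rw [← Finset.prod_pow]
    have h2 : ∀ i j, (v i - v j) * (v j - v i) = (-1) * (v j - v i) ^ 2 := fun i j => by ring
    simp_rw [h2, Finset.prod_mul_distrib, Finset.prod_const]
    rw [Finset.prod_pow_eq_pow_sum]
    congr 2
    simp_rw [Fin.card_Ioi]
    rw [Fin.sum_univ_eq_sum_range (fun i => n - 1 - i), Finset.sum_range_reflect (fun i => i),
      Finset.sum_range_id]
  rw [hprod, hdeg] at hres
  exact (mul_left_cancel₀ (pow_ne_zero _ (neg_ne_zero.mpr one_ne_zero)) hres).symm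

theorem Polynomial.Monic.discr_map {R S : Type*} [CommRing R] [CommRing S] [Nontrivial S]
    {f : Polynomial R} (hf : f.Monic) (φ : R →+* S) : (f.map φ).discr = φ f.discr := by
  have : Nontrivial R := φ.domain_nontrivial
  rcases Nat.eq_zero_or_pos f.natDegree with h0 | hpos
  · have : f = 1 := hf.natDegree_eq_zero.mp h0
    subst this
    rw [Polynomial.map_one, ← Polynomial.C_1, ← Polynomial.C_1, discr_C, discr_C, map_one]
  have h1 := resultant_deriv (natDegree_pos_iff_degree_pos.mp hpos)
  have hdeg := hf.natDegree_map φ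
  have h2 := resultant_deriv (f := f.map φ) (natDegree_pos_iff_degree_pos.mp (hdeg ▸ hpos))
  rw [hdeg, derivative_map, resultant_map_map, h1, (hf.map φ).leadingCoeff, hf.leadingCoeff,
    mul_one, mul_one, map_mul, map_pow, map_neg, map_one] at h2
  have hu : IsUnit ((-1 : S) ^ (f.natDegree * (f.natDegree - 1) / 2)) :=
    (isUnit_one.neg).pow _
  exact (hu.mul_left_cancel h2).symm

/-! ### Discriminant of a characteristic polynomial through power traces. -/

section AlgClosed

variable {K n : Type*} [Field K] [IsAlgClosed K] [Fintype n] [DecidableEq n]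

open Polynomial in
theorem Matrix.det_aeval_eq_prod_roots_charpoly (M : Matrix n n K) (q : K[X]) :
    (aeval M q).det = (M.charpoly.roots.map fun x => q.eval x).prod := by
  have hdet : ∀ a : K, (aeval M (X - C a)).det
      = (M.charpoly.roots.map fun x => (X - C a).eval x).prod := fun a => by
    have h1 : aeval M (X - C a) = -(scalar n a - M) := by
      simp [Matrix.algebraMap_eq_diagonal, Matrix.scalar_apply, Pi.algebraMap_def]
    have h2 := (IsAlgClosed.splits M.charpoly).eval_eq_prod_roots_of_monic M.charpoly_monic a
    rw [Matrix.eval_charpoly] at h2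
    rw [h1, Matrix.det_neg, h2, ← M.charpoly_natDegree_eq_dim,
      (IsAlgClosed.splits M.charpoly).natDegree_eq_card_roots, ← Multiset.card_map (fun x => a - x), ← Multiset.prod_map_neg]
    simp
  have hq' := (IsAlgClosed.splits q).eq_prod_roots
  rw [hq']
  -- Induction on the linear factors alone; the leading coefficient stays fixed and is the base
  -- case.
  generalize q.roots = s
  induction s using Multiset.induction_on with
  | empty =>
    simp [Matrix.algebraMap_eq_diagonal, Pi.algebraMap_def, Matrix.det_diagonal,
      ← (IsAlgClosed.splits M.charpoly).natDegree_eq_card_roots, M.charpoly_natDegree_eq_dim]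
  | cons a s ih =>
    rw [Multiset.map_cons, Multiset.prod_cons, mul_left_comm, map_mul, Matrix.det_mul, ih, hdet a,
      ← Multiset.prod_map_mul]
    simp only [eval_mul]

open Polynomial in
theorem Matrix.charpoly_aeval_roots (M : Matrix n n K) (q : K[X]) :
    (aeval M q).charpoly.roots = M.charpoly.roots.map fun x => q.eval x := by
  have : (aeval M q).charpoly = ((M.charpoly.roots.map fun x => q.eval x).map
      fun y => X - C y).prod := by
    refine Polynomial.funext fun c => ?_
    have h1 : scalar n c - aeval M q = aeval M (C c - q) := by
      simp [Matrix.algebraMap_eq_diagonal, Matrix.scalar_apply, Pi.algebraMap_def]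
    rw [Matrix.eval_charpoly, h1, det_aeval_eq_prod_roots_charpoly, eval_multiset_prod]
    simp
  rw [this, roots_multiset_prod_X_sub_C]

open Polynomial in
theorem Matrix.trace_pow_eq_sum_roots_charpoly (M : Matrix n n K) (m : ℕ) :
    (M ^ m).trace = (M.charpoly.roots.map fun x => x ^ m).sum := by
  have := Matrix.charpoly_aeval_roots M (X ^ m)
  simp only [map_pow, aeval_X, eval_pow, eval_X] at this
  rw [Matrix.trace_eq_sum_roots_charpoly, this]

open scoped Matrix in
theorem Matrix.discr_charpoly_of_isAlgClosed (M : Matrix n n K) {N : ℕ}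
    (hN : Fintype.card n = N) :
    M.charpoly.discr = (Matrix.of fun i j : Fin N => (M ^ (i + j : ℕ)).trace).det := by
  have hs := IsAlgClosed.splits M.charpoly
  have hcard : M.charpoly.roots.card = N := by
    rw [← hs.natDegree_eq_card_roots, M.charpoly_natDegree_eq_dim, hN]
  obtain ⟨l, hl⟩ := Quot.exists_rep M.charpoly.roots
  have hl' : M.charpoly.roots = (l : Multiset K) := hl.symm
  have hlen : l.length = N := by rw [← hcard, hl', Multiset.coe_card]
  subst hlen
  have hroots : M.charpoly.roots = Finset.univ.val.map l.get := by
    rw [hl', Fin.univ_val_map, List.ofFn_get]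
  have hnod : M.charpoly = Lagrange.nodal Finset.univ l.get := by
    conv_lhs => rw [hs.eq_prod_roots_of_monic M.charpoly_monic, hroots, Multiset.map_map]
    rfl
  have htr : (Matrix.of fun i j : Fin l.length => (M ^ (i + j : ℕ)).trace)
      = (Matrix.vandermonde l.get)ᵀ * Matrix.vandermonde l.get := by
    ext i j
    rw [Matrix.vandermonde_transpose_mul_vandermonde, Matrix.of_apply,
      Matrix.trace_pow_eq_sum_roots_charpoly, hroots, Multiset.map_map]
    rfl
  rw [htr, Matrix.det_mul, Matrix.det_transpose, hnod, Lagrange.discr_nodal, sq]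

end AlgClosed

/-- The discriminant of the characteristic polynomial of `M` is the determinant of the Hankel
matrix of the traces of the powers of `M`. -/
theorem Matrix.discr_charpoly {R n : Type*} [CommRing R] [IsDomain R] [Fintype n] [DecidableEq n]
    (M : Matrix n n R) {N : ℕ} (hN : Fintype.card n = N) :
    M.charpoly.discr = (Matrix.of fun i j : Fin N => (M ^ (i + j : ℕ)).trace).det := by
  let φ : R →+* AlgebraicClosure (FractionRing R) :=
    (algebraMap (FractionRing R) _).comp (algebraMap R (FractionRing R))
  have hφ : Function.Injective φ :=
    (algebraMap (FractionRing R) _).injective.comp (IsFractionRing.injective R (FractionRing R))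
  apply hφ
  rw [← M.charpoly_monic.discr_map, ← Matrix.charpoly_map, Matrix.discr_charpoly_of_isAlgClosed _ hN,
    RingHom.map_det]
  congr 1
  ext i j
  simp only [Matrix.of_apply, RingHom.mapMatrix_apply, Matrix.map_apply]
  rw [← RingHom.mapMatrix_apply, ← map_pow, RingHom.mapMatrix_apply, AddMonoidHom.map_trace φ]

/-! ### The generic discriminant and its specialisations. -/

/-- The Hankel matrix of power traces is the trace matrix of the family `1, x, …, x ^ (N - 1)`, so a
change of basis applies. -/
theorem Algebra.discr_charpoly_lmul {R A : Type*} [CommRing R] [IsDomain R] [CommRing A]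
    [Algebra R A] [Module.Free R A] [Module.Finite R A] {N : ℕ} (b : Module.Basis (Fin N) R A)
    (x : A) : (Algebra.lmul R A x).charpoly.discr
      = (b.toMatrix fun j : Fin N => x ^ (j : ℕ)).det ^ 2 * Algebra.discr R b := by
  have h1 : (Algebra.lmul R A x).charpoly = (Algebra.leftMulMatrix b x).charpoly :=
    (LinearMap.charpoly_toMatrix _ b).symm
  have h2 : Matrix.vecMul b
      ((b.toMatrix fun j : Fin N => x ^ (j : ℕ)).map (algebraMap R A))
      = fun j : Fin N => x ^ (j : ℕ) := by
    ext j
    rw [← b.sum_toMatrix_smul_self (fun j : Fin N => x ^ (j : ℕ)) j]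
    simp [Matrix.vecMul, dotProduct, Algebra.smul_def, mul_comm]
  rw [h1, Matrix.discr_charpoly _ (Fintype.card_fin N), ← Algebra.discr_of_matrix_vecMul, h2,
    Algebra.discr_def]
  congr 1
  ext i j
  rw [Matrix.of_apply, Algebra.traceMatrix_apply, Algebra.traceForm_apply, ← pow_add,
    Algebra.trace_eq_matrix_trace b, map_pow]

theorem Algebra.trace_one_tmul {R S B : Type*} [CommRing R] [CommRing S] [CommRing B] [Algebra R S]
    [Algebra R B] [Module.Free R B] [Module.Finite R B] (x : B) :
    Algebra.trace S (S ⊗[R] B) (1 ⊗ₜ x) = algebraMap R S (Algebra.trace R B x) := by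
  rw [Algebra.trace_apply, Algebra.trace_apply, ← LinearMap.trace_baseChange]
  congr 1
  ext y
  simp

theorem Algebra.discr_basis_baseChange {R S B ι : Type*} [CommRing R] [CommRing S] [CommRing B]
    [Algebra R S] [Algebra R B] [Fintype ι] [DecidableEq ι] (e : Module.Basis ι R B) :
    Algebra.discr S (Algebra.TensorProduct.basis S e) = algebraMap R S (Algebra.discr R e) := by
  have := Module.Free.of_basis e
  have := Module.Finite.of_basis e
  rw [Algebra.discr_def, Algebra.discr_def, RingHom.map_det]
  congr 1
  ext i j
  simp [Algebra.traceMatrix_apply, Algebra.traceForm_apply, Algebra.trace_one_tmul]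

/-- The determinant of the powers `1, ξ, …, ξ ^ (n - 1)` of the generic element in the basis
`e`. -/
noncomputable def genericIndex {A B ι : Type*} [CommRing A] [CommRing B] [Algebra A B] [Fintype ι]
    (e : Module.Basis ι A B) : MvPolynomial ι A :=
  (((Algebra.TensorProduct.basis (MvPolynomial ι A) e).reindex (Fintype.equivFin ι)).toMatrix
    fun j : Fin (Fintype.card ι) => genericElement e ^ (j : ℕ)).det

theorem discr_genericCharpoly {A B ι : Type*} [CommRing A] [IsDomain A] [CommRing B] [Algebra A B]
    [Module.Free A B] [Module.Finite A B] [Fintype ι] [DecidableEq ι] (e : Module.Basis ι A B) :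
    (genericCharpoly e).discr = genericIndex e ^ 2 * MvPolynomial.C (Algebra.discr A e) := by
  rw [genericCharpoly, Algebra.discr_charpoly_lmul
    ((Algebra.TensorProduct.basis (MvPolynomial ι A) e).reindex (Fintype.equivFin ι)),
    Module.Basis.coe_reindex, Algebra.discr_reindex, Algebra.discr_basis_baseChange,
    MvPolynomial.algebraMap_eq, genericIndex]

theorem Algebra.TensorProduct.basis_repr_map {R S S' B ι : Type*} [CommRing R] [CommRing S]
    [CommRing S'] [CommRing B] [Algebra R S] [Algebra R S'] [Algebra R B] (e : Module.Basis ι R B)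
    (φ : S →ₐ[R] S') (x : S ⊗[R] B) (i : ι) :
    (Algebra.TensorProduct.basis S' e).repr (Algebra.TensorProduct.map φ (AlgHom.id R B) x) i
      = φ ((Algebra.TensorProduct.basis S e).repr x i) := by
  induction x using TensorProduct.induction_on with
  | zero => simp
  | tmul s b => simp [Algebra.TensorProduct.basis_repr_tmul]
  | add x y hx hy => simp [hx, hy]

theorem aeval_genericIndex {A B k ι : Type*} [CommRing A] [CommRing B] [Algebra A B] [Fintype ι]
    [CommRing k] [Algebra A k] (e : Module.Basis ι A B) (a : ι → k) :
    MvPolynomial.aeval a (genericIndex e) =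
      (((Algebra.TensorProduct.basis k e).reindex (Fintype.equivFin ι)).toMatrix
        fun j : Fin (Fintype.card ι) => (∑ i, a i ⊗ₜ[A] e i) ^ (j : ℕ)).det := by
  rw [genericIndex, AlgHom.map_det]
  congr 1
  ext i j
  have h : Algebra.TensorProduct.map (MvPolynomial.aeval a) (AlgHom.id A B) (genericElement e)
      = ∑ i, a i ⊗ₜ[A] e i := by
    simp [genericElement]
  simp only [AlgHom.mapMatrix_apply, Matrix.map_apply, Module.Basis.toMatrix_apply,
    Module.Basis.repr_reindex_apply]
  rw [← Algebra.TensorProduct.basis_repr_map, map_pow, h]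

/-- If some element of `k ⊗ B` has a minimal polynomial of degree at least the rank, the generic
index does not vanish over `k`. -/
theorem exists_aeval_genericIndex_ne_zero {A B k ι : Type*} [CommRing A] [CommRing B] [Algebra A B]
    [Fintype ι] [Field k] [Algebra A k] (e : Module.Basis ι A B) (b : k ⊗[A] B)
    (hb : Fintype.card ι ≤ (minpoly k b).natDegree) :
    ∃ a : ι → k, MvPolynomial.aeval a (genericIndex e) ≠ 0 := by
  refine ⟨(Algebra.TensorProduct.basis k e).repr b, ?_⟩
  have hsum : ∑ i, (Algebra.TensorProduct.basis k e).repr b i ⊗ₜ[A] e i = b := by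
    conv_rhs => rw [← (Algebra.TensorProduct.basis k e).sum_repr b]
    simp [TensorProduct.smul_tmul']
  rw [aeval_genericIndex, hsum]
  have hli : LinearIndependent k fun j : Fin (Fintype.card ι) => b ^ (j : ℕ) :=
    (linearIndependent_pow b).comp (Fin.castLE hb) (Fin.castLE_injective hb)
  set E := (Algebra.TensorProduct.basis k e).reindex (Fintype.equivFin ι)
  have hspan : Submodule.span k (Set.range fun j : Fin (Fintype.card ι) => b ^ (j : ℕ)) = ⊤ :=
    have := Module.Finite.of_basis E
    hli.span_eq_top_of_card_eq_finrank' (Module.finrank_eq_card_basis E).symm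
  exact ((Module.Basis.is_basis_iff_det E).mp ⟨hli, hspan⟩).ne_zero

/-! ### Single generators of `B ⧸ P ^ e`. -/

theorem Polynomial.aeval_map_zmod {p : ℕ} {B R : Type*} [CommRing B] [CommRing R]
    [Algebra (ZMod p) R] (π : B →+* R) (θ : B) (h : Polynomial ℤ) :
    Polynomial.aeval (π θ) (h.map (Int.castRingHom (ZMod p))) = π (Polynomial.aeval θ h) := by
  rw [aeval_def, aeval_def, eval₂_map, hom_eval₂]
  congr 1
  exact RingHom.ext_int _ _

theorem Ideal.pow_notMem_pow_succ {B : Type*} [CommRing B] [IsDedekindDomain B] {P : Ideal B}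
    [P.IsPrime] (hP : P ≠ ⊥) {x : B} (hx : x ∈ P) (hx2 : x ∉ P ^ 2) (m : ℕ) :
    x ^ m ∉ P ^ (m + 1) := by
  intro h
  have hprime : Prime P := Ideal.prime_of_isPrime hP inferInstance
  rw [← Ideal.span_singleton_le_iff_mem, ← Ideal.dvd_iff_le] at hx hx2
  rw [← Ideal.span_singleton_le_iff_mem, ← Ideal.dvd_iff_le, ← Ideal.span_singleton_pow] at h
  obtain ⟨J, hJ⟩ := hx
  rw [hJ, mul_pow, pow_succ, mul_dvd_mul_iff_left (pow_ne_zero _ hprime.ne_zero)] at h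
  have := hprime.dvd_of_dvd_pow h
  exact hx2 (by rw [hJ, sq]; exact mul_dvd_mul_left _ this)

/-- Given a maximal ideal `P`, and an integral polynomial with a simple root modulo `P`, the root
lifts to an element at which the value of the polynomial lies in `P` but not in `P ^ 2`. -/
theorem Ideal.exists_aeval_notMem_sq {B : Type*} [CommRing B] [IsDedekindDomain B] {P : Ideal B}
    [P.IsMaximal] (hP : P ≠ ⊥) (h : Polynomial ℤ) (α : B ⧸ P) (h0 : Polynomial.aeval α h = 0)
    (h1 : Polynomial.aeval α h.derivative ≠ 0) :
    ∃ θ : B, Ideal.Quotient.mk P θ = α ∧ Polynomial.aeval θ h ∈ P ∧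
      Polynomial.aeval θ h ∉ P ^ 2 := by
  obtain ⟨θ, rfl⟩ := Ideal.Quotient.mk_surjective α
  have key : ∀ (θ : B) (g : Polynomial ℤ), Polynomial.aeval (Ideal.Quotient.mk P θ) g
      = Ideal.Quotient.mk P (Polynomial.aeval θ g) := fun θ g =>
    Polynomial.aeval_algHom_apply (Ideal.Quotient.mkₐ ℤ P) θ g
  rw [key, Ideal.Quotient.eq_zero_iff_mem] at h0
  rw [key, Ne, Ideal.Quotient.eq_zero_iff_mem] at h1
  by_cases h2 : Polynomial.aeval θ h ∈ P ^ 2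
  swap
  · exact ⟨θ, rfl, h0, h2⟩
  obtain ⟨ϖ, hϖ, hϖ2⟩ : ∃ x ∈ P, x ∉ P ^ 2 := by
    have := Ideal.pow_right_strictAnti P hP (Ideal.IsPrime.ne_top inferInstance)
      (show 1 < 2 by norm_num)
    simp only [pow_one] at this
    exact SetLike.exists_of_lt this
  -- If `h(θ)` is in `P ^ 2`, then `h(θ + ϖ) ≡ h'(θ) ϖ` modulo `P ^ 2`, which is nonzero because the
  -- root is simple.
  obtain ⟨k, hk⟩ := Polynomial.binomExpansion (h.map (algebraMap ℤ B)) θ ϖ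
  rw [Polynomial.derivative_map, Polynomial.eval_map_algebraMap, Polynomial.eval_map_algebraMap,
    Polynomial.eval_map_algebraMap] at hk
  have hkϖ : k * ϖ ^ 2 ∈ P ^ 2 := Ideal.mul_mem_left _ _ (Ideal.pow_mem_pow hϖ 2)
  have hnot : Polynomial.aeval (θ + ϖ) h ∉ P ^ 2 := by
    intro hmem
    have h3 : Polynomial.aeval θ h.derivative * ϖ ∈ P ^ 2 := by
      have := (P ^ 2).sub_mem ((P ^ 2).sub_mem hmem h2) hkϖ
      rw [hk] at this
      convert this using 1
      ring
    rcases Ideal.IsPrime.mul_mem_pow P h3 with h | h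
    · exact h1 h
    · exact hϖ2 h
  refine ⟨θ + ϖ, ?_, ?_, hnot⟩
  · rw [map_add, Ideal.Quotient.eq_zero_iff_mem.mpr hϖ, add_zero]
  · rw [hk]
    exact P.add_mem (P.add_mem h0 (P.mul_mem_left _ hϖ))
      (P.mul_mem_left _ (P.pow_mem_of_mem hϖ 2 two_pos))

/-- For a maximal ideal `P` with finite residue field, `B ⧸ P ^ e` is generated over the prime
field by one element. -/
theorem Ideal.exists_le_natDegree_minpoly_quotient_pow {B : Type*} [CommRing B]
    [IsDedekindDomain B] {P : Ideal B} [P.IsMaximal] (hP : P ≠ ⊥) {p : ℕ} [Fact p.Prime]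
    [Algebra (ZMod p) (B ⧸ P)] [Finite (B ⧸ P)] (e : ℕ) [Algebra (ZMod p) (B ⧸ P ^ e)]
    [Finite (B ⧸ P ^ e)] :
    ∃ θ : B, e * Module.finrank (ZMod p) (B ⧸ P)
      ≤ (minpoly (ZMod p) (Ideal.Quotient.mk (P ^ e) θ)).natDegree := by
  let := Ideal.Quotient.field P
  obtain ⟨α, hα⟩ := Field.exists_primitive_element (ZMod p) (B ⧸ P)
  rw [Field.primitive_element_iff_minpoly_natDegree_eq] at hα
  have hint : IsIntegral (ZMod p) α := IsIntegral.of_finite _ _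
  have hsurj := Polynomial.map_surjective (Int.castRingHom (ZMod p)) (ZMod.ringHom_surjective _)
  obtain ⟨h, hh⟩ := hsurj (minpoly (ZMod p) α)
  have hred : ∀ g : Polynomial ℤ,
      Polynomial.aeval α (g.map (Int.castRingHom (ZMod p))) = Polynomial.aeval α g :=
    fun g => Polynomial.aeval_map_zmod (RingHom.id _) α g
  obtain ⟨θ, hθα, hθ1, hθ2⟩ := Ideal.exists_aeval_notMem_sq hP h α
    (by rw [← hred, hh, minpoly.aeval])
    (by
      rw [← hred, ← Polynomial.derivative_map, hh]
      exact Polynomial.Separable.aeval_derivative_ne_zero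
        (Algebra.IsSeparable.isSeparable (ZMod p) α) (minpoly.aeval _ _))
  refine ⟨θ, ?_⟩
  set g := minpoly (ZMod p) (Ideal.Quotient.mk (P ^ e) θ)
  have hg0 : g ≠ 0 := minpoly.ne_zero (IsIntegral.of_finite _ _)
  obtain ⟨u, hgu, hu⟩ := (FiniteMultiplicity.of_prime_left (minpoly.prime hint) hg0).exists_eq_pow_mul_and_not_dvd
  set m := multiplicity (minpoly (ZMod p) α) g
  obtain ⟨U, hU⟩ := hsurj u
  have hUP : Polynomial.aeval θ U ∉ P := by
    rw [← Ideal.Quotient.eq_zero_iff_mem, ← Polynomial.aeval_map_zmod (p := p), hU, hθα]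
    exact fun h => hu (minpoly.dvd _ _ h)
  have hmem : Polynomial.aeval θ h ^ m * Polynomial.aeval θ U ∈ P ^ e := by
    rw [← Ideal.Quotient.eq_zero_iff_mem, ← map_pow, ← map_mul,
      ← Polynomial.aeval_map_zmod (p := p), Polynomial.map_mul, Polynomial.map_pow, hU, hh, ← hgu]
    exact minpoly.aeval _ _
  -- `h(θ) ^ m * U(θ)` has `P`-order exactly `m`, yet it lies in `P ^ e`.
  have hm : e ≤ m := by
    by_contra hlt
    rw [mul_comm] at hmem
    rcases Ideal.IsPrime.mul_mem_pow P hmem with h | h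
    · exact hUP h
    · exact Ideal.pow_notMem_pow_succ hP hθ1 hθ2 m (Ideal.pow_le_pow_right (by omega) h)
  have hu0 : u ≠ 0 := by rintro rfl; exact hg0 (by rw [hgu, mul_zero])
  rw [hgu, Polynomial.natDegree_mul (pow_ne_zero _ (minpoly.ne_zero hint)) hu0,
    Polynomial.natDegree_pow, hα]
  exact (Nat.mul_le_mul_right _ hm).trans (Nat.le_add_right _ _)

/-! ### Gluing generators over an algebraically closed field. -/

theorem natDegree_minpoly_le_one_tmul (F : Type*) {k R : Type*} [Field F] [Field k] [CommRing R]
    [Algebra F k] [Algebra F R] [Module.Finite F R] (x : R) :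
    (minpoly F x).natDegree ≤ (minpoly k ((1 : k) ⊗ₜ[F] x)).natDegree := by
  have hF := linearIndependent_pow (K := F) x
  let e := Module.Basis.extend hF.linearIndepOn_id
  have hli : LinearIndependent k fun i : Fin (minpoly F x).natDegree =>
      ((1 : k) ⊗ₜ[F] x) ^ (i : ℕ) := by
    convert (Algebra.TensorProduct.basis k e).linearIndependent.comp
      (fun i : Fin (minpoly F x).natDegree =>
        ⟨x ^ (i : ℕ), hF.linearIndepOn_id.subset_extend _ ⟨i, rfl⟩⟩)
      (fun i j h => hF.injective (Subtype.ext_iff.mp h)) using 2 with i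
    simp [e, Module.Basis.extend_apply_self]
  have hint : IsIntegral k ((1 : k) ⊗ₜ[F] x) := IsIntegral.of_finite _ _
  by_contra! hlt
  have h0 := minpoly.aeval k ((1 : k) ⊗ₜ[F] x)
  rw [Polynomial.aeval_eq_sum_range' hlt, ← Fin.sum_univ_eq_sum_range
    (fun i => (minpoly k ((1 : k) ⊗ₜ[F] x)).coeff i • ((1 : k) ⊗ₜ[F] x) ^ i)] at h0
  have := Fintype.linearIndependent_iff.mp hli _ h0 ⟨_, hlt⟩
  exact one_ne_zero ((minpoly.monic hint).symm.trans this)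

/-- Over an algebraically closed field, finitely many nonzero polynomials can be translated so as to
become pairwise coprime. -/
theorem Polynomial.exists_pairwise_isCoprime_comp_X_sub_C {k ι : Type*} [Field k] [IsAlgClosed k]
    [Finite ι] (f : ι → Polynomial k) (hf : ∀ i, f i ≠ 0) :
    ∃ c : ι → k, Pairwise (Function.onFun IsCoprime fun i => (f i).comp (X - C (c i))) := by
  classical
  have := Fintype.ofFinite ι
  -- Translation by `c` moves a root `r` of `f i` to `r + c i`; it meets `s + c j` exactly when `c i
  -- - c j = s - r`. A point off all these hyperplanes is wanted.
  let q : MvPolynomial ι k := ∏ ij ∈ Finset.univ.filter fun ij : ι × ι => ij.1 ≠ ij.2,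
    ∏ rs ∈ (f ij.1).roots.toFinset ×ˢ (f ij.2).roots.toFinset,
      (MvPolynomial.X ij.1 - MvPolynomial.X ij.2 - MvPolynomial.C (rs.2 - rs.1))
  have hq : q ≠ 0 := by
    refine Finset.prod_ne_zero_iff.mpr fun ij hij => Finset.prod_ne_zero_iff.mpr fun rs _ h => ?_
    have hne : ij.1 ≠ ij.2 := (Finset.mem_filter.mp hij).2
    have := congrArg (MvPolynomial.eval ((Pi.single ij.1 (rs.2 - rs.1 + 1) : ι → k))) h
    simp [hne.symm] at this
  obtain ⟨c, hc⟩ : ∃ c, MvPolynomial.eval c q ≠ 0 := by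
    by_contra! h
    exact hq (MvPolynomial.funext fun x => by rw [h, map_zero])
  refine ⟨c, fun i j hij => ?_⟩
  change IsCoprime _ _
  rw [Polynomial.isCoprime_iff_aeval_ne_zero_of_isAlgClosed k k]
  intro a
  by_contra! h
  simp only [coe_aeval_eq_eval, eval_comp, eval_sub, eval_X, eval_C] at h
  apply hc
  rw [map_prod]
  refine Finset.prod_eq_zero (i := (i, j)) (by simp [hij]) ?_
  rw [map_prod]
  refine Finset.prod_eq_zero (i := (a - c i, a - c j)) ?_ (by simp)
  simp [hf i, hf j, h.1, h.2]

/-- The minimal polynomial of `b` is divisible by that of each `π i b`; once these are pairwise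
coprime it is divisible by their product. Translation by constants preserves degrees. -/
theorem exists_sum_natDegree_minpoly_le {k A ι : Type*} {R : ι → Type*} [Field k] [IsAlgClosed k]
    [Fintype ι] [CommRing A] [Algebra k A] [Module.Finite k A] [∀ i, CommRing (R i)]
    [∀ i, Algebra k (R i)] (π : ∀ i, A →ₐ[k] R i) (x : ∀ i, R i) (hx : ∀ i, IsIntegral k (x i))
    (hπ : ∀ y : ∀ i, R i, (∀ i, ∃ c, y i = x i + algebraMap k (R i) c) → ∃ b, ∀ i, π i b = y i) :
    ∃ b : A, ∑ i, (minpoly k (x i)).natDegree ≤ (minpoly k b).natDegree := by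
  obtain ⟨c, hc⟩ := Polynomial.exists_pairwise_isCoprime_comp_X_sub_C
    (fun i => minpoly k (x i)) fun i => minpoly.ne_zero (hx i)
  obtain ⟨b, hb⟩ := hπ (fun i => x i + algebraMap k (R i) (c i)) fun i => ⟨c i, rfl⟩
  refine ⟨b, ?_⟩
  have hdvd : ∏ i, (minpoly k (x i)).comp (Polynomial.X - Polynomial.C (c i)) ∣ minpoly k b := by
    refine Fintype.prod_dvd_of_coprime hc fun i => ?_
    rw [← minpoly.add_algebraMap, ← hb i]
    exact minpoly.dvd _ _ (by rw [Polynomial.aeval_algHom_apply, minpoly.aeval, map_zero])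
  have := Polynomial.natDegree_le_of_dvd hdvd (minpoly.ne_zero (IsIntegral.of_finite k b))
  rw [Polynomial.natDegree_prod_of_monic _ _ fun i _ =>
    (minpoly.monic (hx i)).comp_X_sub_C _] at this
  simpa [Polynomial.natDegree_comp] using this

theorem TensorProduct.exists_algHom_int_tmul {F k B R : Type*} [CommRing F] [CommRing k]
    [Algebra F k] [CommRing B] [CommRing R] [Algebra F R] (φ : B →+* R) :
    ∃ π : k ⊗[ℤ] B →ₐ[k] k ⊗[F] R, ∀ c x, π (c ⊗ₜ x) = c ⊗ₜ φ x := by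
  let : Algebra ℤ (k ⊗[F] R) := Ring.toIntAlgebra _
  have : IsScalarTower ℤ k (k ⊗[F] R) := AddCommGroup.intIsScalarTower
  refine ⟨Algebra.TensorProduct.lift (Algebra.ofId k _)
    ((Algebra.TensorProduct.includeRight : R →ₐ[F] k ⊗[F] R).toRingHom.comp φ).toIntAlgHom
    fun _ _ => Commute.all _ _, fun c x => ?_⟩
  simp [Algebra.ofId_apply]

/-- The base change of the ring of integers to an algebraically closed field of characteristic `p`
has an element whose minimal polynomial has degree the rank. -/
theorem NumberField.exists_finrank_le_natDegree_minpoly (K : Type*) [Field K] [NumberField K]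
    (p : ℕ) [Fact p.Prime] (k : Type*) [Field k] [IsAlgClosed k] [Algebra (ZMod p) k] :
    ∃ b : k ⊗[ℤ] RingOfIntegers K,
      Module.finrank ℤ (RingOfIntegers K) ≤ (minpoly k b).natDegree := by
  classical
  let B := RingOfIntegers K
  let 𝔭 : Ideal ℤ := Ideal.span {(p : ℤ)}
  have hp : (p : ℤ) ≠ 0 := by exact_mod_cast (Fact.out : p.Prime).ne_zero
  have h𝔭0 : 𝔭 ≠ ⊥ := by simpa [𝔭] using hp
  have : 𝔭.IsMaximal := Int.ideal_span_isMaximal_of_prime p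
  have hfin : (𝔭.primesOver B).Finite := IsDedekindDomain.primesOver_finite _ _
  have := hfin.fintype
  have hsum := Ideal.sum_ramification_inertia_eq_finrank 𝔭 B
  let e : 𝔭.primesOver B → ℕ := fun Q => Q.1.ramificationIdx ℤ
  have hmapne : 𝔭.map (algebraMap ℤ B) ≠ ⊥ := Ideal.map_ne_bot_of_ne_bot h𝔭0
  have hprime : ∀ Q : 𝔭.primesOver B, Q.1.IsPrime := fun Q => Q.2.1
  have hlies : ∀ Q : 𝔭.primesOver B, Q.1.LiesOver 𝔭 := fun Q => Q.2.2
  have hne : ∀ Q : 𝔭.primesOver B, Q.1 ≠ ⊥ := fun Q => Ideal.ne_bot_of_mem_primesOver h𝔭0 Q.2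
  have hmax : ∀ Q : 𝔭.primesOver B, Q.1.IsMaximal := fun Q => (hprime Q).isMaximal (hne Q)
  have hmem : ∀ Q : 𝔭.primesOver B, (p : B) ∈ Q.1 ^ e Q := fun Q => by
    have h1 : Q.1 ^ e Q ∣ 𝔭.map (algebraMap ℤ B) := by
      change Q.1 ^ Q.1.ramificationIdx ℤ ∣ _
      rw [Ideal.IsDedekindDomain.ramificationIdx_eq_multiplicity 𝔭 Q.1 hmapne]
      exact pow_multiplicity_dvd _ _
    refine Ideal.dvd_iff_le.mp h1 ?_
    have := Ideal.mem_map_of_mem (algebraMap ℤ B) (Ideal.mem_span_singleton_self (p : ℤ))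
    simpa using this
  have alg : ∀ I : Ideal B, (p : B) ∈ I → Nonempty (Algebra (ZMod p) (B ⧸ I)) := fun I hI =>
    ⟨ZMod.algebra' (B ⧸ I) (ringChar (B ⧸ I)) (ringChar.dvd (by
      rw [← map_natCast (Ideal.Quotient.mk I)]; exact Ideal.Quotient.eq_zero_iff_mem.mpr hI))⟩
  have alge : ∀ Q : 𝔭.primesOver B, Algebra (ZMod p) (B ⧸ Q.1 ^ e Q) := fun Q =>
    (alg _ (hmem Q)).some
  have hmem1 : ∀ Q : 𝔭.primesOver B, (p : B) ∈ Q.1 := fun Q =>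
    Ideal.pow_le_self (Ideal.ramificationIdx_pos Q.1 ℤ).ne' (hmem Q)
  have alg1 : ∀ Q : 𝔭.primesOver B, Algebra (ZMod p) (B ⧸ Q.1) := fun Q =>
    (alg _ (hmem1 Q)).some
  have hfinq : ∀ Q : 𝔭.primesOver B, Finite (B ⧸ Q.1) := fun Q =>
    Ideal.finiteQuotientOfFreeOfNeBot _ (hne Q)
  have hfinqe : ∀ Q : 𝔭.primesOver B, Finite (B ⧸ Q.1 ^ e Q) := fun Q =>
    Ideal.finiteQuotientOfFreeOfNeBot _ (pow_ne_zero _ (hne Q))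
  have hf : ∀ Q : 𝔭.primesOver B, Module.finrank (ZMod p) (B ⧸ Q.1) = Q.1.inertiaDeg ℤ := fun Q => by
    have h1 := Ideal.cardQuot_pow_inertiaDeg 𝔭 Q.1
    have h2 : Nat.card (B ⧸ Q.1) = p ^ Module.finrank (ZMod p) (B ⧸ Q.1) := by
      rw [Module.natCard_eq_pow_finrank (K := ZMod p), Nat.card_zmod]
    have h3 : 𝔭.cardQuot = p := by
      have := Ideal.absNorm_span_singleton (p : ℤ)
      rw [Ideal.absNorm_apply] at this
      simpa [𝔭] using this
    have h4 : Q.1.cardQuot = Nat.card (B ⧸ Q.1) := Submodule.cardQuot_apply _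
    rw [h3, h4, h2] at h1
    exact (Nat.pow_right_injective (Fact.out : p.Prime).two_le h1).symm
  choose θ hθ using fun Q : 𝔭.primesOver B =>
    Ideal.exists_le_natDegree_minpoly_quotient_pow (P := Q.1) (hne Q) (p := p) (e Q)
  let R : 𝔭.primesOver B → Type _ := fun Q => k ⊗[ZMod p] (B ⧸ Q.1 ^ e Q)
  choose π hπ using fun Q : 𝔭.primesOver B => TensorProduct.exists_algHom_int_tmul (F := ZMod p) (k := k)
    (Ideal.Quotient.mk (Q.1 ^ e Q))
  -- The `ε Q` lift the idempotents of the product of the `B ⧸ Q ^ e Q`.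
  choose ε hε using fun Q : 𝔭.primesOver B =>
    IsDedekindDomain.exists_forall_sub_mem_ideal (s := Finset.univ)
      (fun Q' : 𝔭.primesOver B => Q'.1) e
      (fun Q' _ => Ideal.prime_of_isPrime (hne Q') (hprime Q'))
      (fun Q' _ Q'' _ h => fun h' => h (Subtype.ext h')) (fun Q' => if Q'.1 = Q then 1 else 0)
  have hε' : ∀ Q Q', Ideal.Quotient.mk (Q'.1 ^ e Q') (ε Q) = if Q' = Q then 1 else 0 :=
    fun Q Q' => by
      have := Ideal.Quotient.eq.mpr (hε Q Q' (Finset.mem_univ _))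
      rw [this]
      split_ifs <;> simp
  obtain ⟨b, hb⟩ := exists_sum_natDegree_minpoly_le (k := k) π
    (fun Q => (1 : k) ⊗ₜ Ideal.Quotient.mk (Q.1 ^ e Q) (θ Q))
    (fun Q => IsIntegral.of_finite _ _) (by
      intro y hy
      choose c hc using hy
      refine ⟨∑ Q, (1 ⊗ₜ θ Q + c Q ⊗ₜ 1) * (1 ⊗ₜ ε Q), fun Q => ?_⟩
      rw [map_sum, Finset.sum_eq_single Q]
      · rw [map_mul, map_add, hπ, hπ, hπ, hε', if_pos rfl, hc]
        rw [← Algebra.TensorProduct.one_def, mul_one]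
        rfl
      · intro Q' _ hne
        rw [map_mul, hπ Q 1 (ε Q'), hε', if_neg hne.symm, TensorProduct.tmul_zero, mul_zero]
      · simp)
  refine ⟨b, le_trans ?_ hb⟩
  rw [← hsum]
  refine Finset.sum_le_sum fun Q _ => ?_
  rw [← hf Q]
  exact (hθ Q).trans (natDegree_minpoly_le_one_tmul (ZMod p) _)

/-! ### The discriminant ideal. -/

/-- A wedge of `n` basis vectors either permutes `b`, giving a sign, or repeats a vector and
vanishes. -/
theorem exteriorPower.span_ιMulti_basis {R M : Type*} [CommRing R] [AddCommGroup M] [Module R M]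
    {n : ℕ} (b : Module.Basis (Fin n) R M) :
    Submodule.span R {exteriorPower.ιMulti R n b} = ⊤ := by
  rw [eq_top_iff, ← exteriorPower.ιMulti_span_of_span R n M b.span_eq, Submodule.span_le]
  rintro _ ⟨a, ha, rfl⟩
  choose σ hσ using fun i => ha (Set.mem_range_self i)
  obtain rfl : b ∘ σ = a := funext hσ
  by_cases hinj : Function.Injective σ
  · have := (exteriorPower.ιMulti R n).map_perm b
      (Equiv.ofBijective σ (Finite.injective_iff_bijective.mp hinj))
    change exteriorPower.ιMulti R n (b ∘ σ) = _ at this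
    rw [SetLike.mem_coe]
    rw [this, Units.smul_def, ← Int.cast_smul_eq_zsmul R]
    exact Submodule.smul_mem _ _ (Submodule.mem_span_singleton_self _)
  · rw [(exteriorPower.ιMulti R n).map_eq_zero_of_not_injective _ fun h => hinj h.of_comp]
    exact Submodule.zero_mem _

theorem discriminantMap_ιMulti {S E : Type*} [CommRing S] [CommRing E] [Algebra S E] {n : ℕ}
    (v : Fin n → E) : discriminantMap S E n
      (exteriorPower.ιMulti S n v ⊗ₜ exteriorPower.ιMulti S n v) = Algebra.discr S v := by
  rw [discriminantMap, TensorProduct.lift.tmul, LinearMap.comp_apply,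
    exteriorPower.map_apply_ιMulti, exteriorPower.pairingDual_ιMulti_ιMulti, Algebra.discr_def,
    ← Matrix.det_transpose]
  rfl

theorem discriminantIdeal_eq_span_discr {S E ι : Type*} [CommRing S] [Nontrivial S] [CommRing E]
    [Algebra S E] [Fintype ι] [DecidableEq ι] (e : Module.Basis ι S E) :
    discriminantIdeal S E = Ideal.span {Algebra.discr S e} := by
  let σ : ι ≃ Fin (Module.finrank S E) := Fintype.equivFinOfCardEq
    (Module.finrank_eq_card_basis e).symm
  rw [← Algebra.discr_reindex S e σ, ← Module.Basis.coe_reindex, ← discriminantMap_ιMulti]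
  set b := e.reindex σ
  set ω := exteriorPower.ιMulti S (Module.finrank S E) b
  have hω : ∀ u, ∃ c : S, c • ω = u := fun u => Submodule.mem_span_singleton.mp
    ((exteriorPower.span_ιMulti_basis b).ge (Submodule.mem_top (x := u)))
  refine le_antisymm ?_ ?_
  · rintro _ ⟨t, rfl⟩
    induction t using TensorProduct.induction_on with
    | zero => rw [map_zero]; exact Ideal.zero_mem _
    | tmul u v =>
      obtain ⟨c, rfl⟩ := hω u
      obtain ⟨c', rfl⟩ := hω v
      rw [TensorProduct.smul_tmul_smul, map_smul]
      exact Ideal.mul_mem_left _ _ (Ideal.mem_span_singleton_self _)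
    | add x y hx hy => rw [map_add]; exact Ideal.add_mem _ hx hy
  · rw [Ideal.span_singleton_le_iff_mem]
    exact ⟨_, rfl⟩

/-! ### Contents and the conclusion. -/

theorem mvContent_nonneg {ι : Type*} (p : MvPolynomial ι ℤ) : 0 ≤ mvContent p := by
  rw [← abs_eq_self, Int.abs_eq_normalize]
  exact Finset.normalize_gcd

theorem dvd_mvContent_iff {ι : Type*} (p : MvPolynomial ι ℤ) (m : ℤ) :
    m ∣ mvContent p ↔ MvPolynomial.C m ∣ p := by
  rw [mvContent, Finset.dvd_gcd_iff, MvPolynomial.C_dvd_iff_dvd_coeff]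
  refine ⟨fun h i => ?_, fun h i _ => h i⟩
  by_cases hi : i ∈ p.support
  · exact h i hi
  · rw [MvPolynomial.notMem_support_iff.mp hi]
    exact dvd_zero m

theorem mvContent_mul_C_of_primitive {ι : Type*} (q : MvPolynomial ι ℤ) {d : ℤ} (hd : d ≠ 0)
    (hq : ∀ p : ℕ, p.Prime → ¬ MvPolynomial.C (p : ℤ) ∣ q) :
    mvContent (q * MvPolynomial.C d) = |d| := by
  obtain ⟨c, hc⟩ := (dvd_mvContent_iff (q * MvPolynomial.C d) d).mpr (dvd_mul_left _ _)
  have hC : (MvPolynomial.C d : MvPolynomial ι ℤ) ≠ 0 := by simpa using hd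
  -- A prime `p` dividing the cofactor `c` would make `p * d` divide `q * d`, hence `p` divide `q`.
  have hunit : c.natAbs = 1 := by
    by_contra h
    obtain ⟨p, hp, hpc⟩ := Nat.exists_prime_and_dvd h
    refine hq p hp ?_
    have : (p : ℤ) * d ∣ mvContent (q * MvPolynomial.C d) := by
      rw [hc, mul_comm]
      exact mul_dvd_mul_left _ (Int.natCast_dvd.mpr hpc)
    rw [dvd_mvContent_iff, MvPolynomial.C_mul] at this
    exact (mul_dvd_mul_iff_right hC).mp this
  rw [← abs_of_nonneg (mvContent_nonneg _), hc, abs_mul, Int.abs_eq_natAbs c, hunit, Nat.cast_one,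
    mul_one]

theorem NumberField.not_C_dvd_genericIndex_sq (K : Type*) [Field K] [NumberField K] {ι : Type*}
    [Fintype ι] (e : Module.Basis ι ℤ (RingOfIntegers K)) (p : ℕ) (hp : p.Prime) :
    ¬ MvPolynomial.C (p : ℤ) ∣ genericIndex e ^ 2 := by
  rintro ⟨q, hq⟩
  have : Fact p.Prime := ⟨hp⟩
  obtain ⟨b, hb⟩ := NumberField.exists_finrank_le_natDegree_minpoly K p
    (AlgebraicClosure (ZMod p))
  rw [Module.finrank_eq_card_basis e] at hb
  obtain ⟨a, ha⟩ := exists_aeval_genericIndex_ne_zero e b hb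
  have h := congrArg (MvPolynomial.aeval a) hq
  rw [map_pow, map_mul, MvPolynomial.aeval_C, map_natCast, CharP.cast_eq_zero, zero_mul] at h
  exact ha (pow_eq_zero_iff two_ne_zero |>.mp h)

theorem mainTheorem9 (K : Type*) [Field K] [NumberField K] {ι : Type*} [Fintype ι]
    (e : Module.Basis ι ℤ (NumberField.RingOfIntegers K)) :
    Ideal.span {mvContent (genericCharpoly e).discr} =
        discriminantIdeal ℤ (NumberField.RingOfIntegers K) ∧
      mvContent (genericCharpoly e).discr = |NumberField.discr K| := by
  classical
  have h : mvContent (genericCharpoly e).discr = |NumberField.discr K| := by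
    rw [discr_genericCharpoly, NumberField.discr_eq_discr]
    exact mvContent_mul_C_of_primitive _ (NumberField.discr_ne_zero K)
      (NumberField.not_C_dvd_genericIndex_sq K e)
  refine ⟨?_, h⟩
  rw [h, discriminantIdeal_eq_span_discr e, NumberField.discr_eq_discr,
    Ideal.span_singleton_eq_span_singleton]
  exact Int.associated_iff.mpr (abs_choice _)
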